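/- **Theorem 3.4.** Let $N\in\mathbb N$ and $p\in\mathbb R$ with $1<p<N$. For $\delta>0$ and measurable $u:\mathbb R^N\to\mathbb R$ put $$I_\delta(u):=\iint_{\{(x,y)\in\mathbb R^N\times\mathbb R^N:\ |u(y)-u(x)|>\delta\}}\frac{\delta^p}{|x-y|^{N+p}}\,dx\,dy\in[0,\infty].$$ Let $(\delta_n)_{n\in\mathbb N}$ be a sequence of positive real numbers with $\delta_n\to0$, and let $(u_n)_{n\in\mathbb N}$ be a sequence of radially symmetric decreasing functions on $\mathbb R^N$, i.e. for each $n$ there is a non-increasing $f_n:(0,\infty)\to\mathbb R$ with $u_n(x)=f_n(|x|)$ for almost every $x\in\mathbb R^N$. Assume that $(u_n)$ is bounded in $L^p(\mathbb R^N)$ and that $(I_{\delta_n}(u_n))$ is bounded, i.e. $\sup_n I_{\delta_n}(u_n)<\infty$. Then, for every real $r$ with $p<r<\frac{Np}{N-p}$, every $u_n$ belongs to $L^r(\mathbb R^N)$ and $(u_n)$ is pre-compact in $L^r(\mathbb R^N)$, i.e. the set $\{u_n:n\in\mathbb N\}$ has compact closure in $L^r(\mathbb R^N)$. -/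

import Mathlib

open MeasureTheory Filter Topology
open scoped ENNReal NNReal

/-- The nonlocal energy `I_δ(u) = ∬_{|u(y) - u(x)| > δ} δ^p / |x - y|^(N + p) dx dy`,
as an element of `[0, ∞]`, for `u : ℝ^N → ℝ` and `δ > 0`. -/
noncomputable def nonlocalEnergy {N : ℕ} (p δ : ℝ) (u : EuclideanSpace ℝ (Fin N) → ℝ) : ℝ≥0∞ :=
  ∫⁻ z in {z : EuclideanSpace ℝ (Fin N) × EuclideanSpace ℝ (Fin N) | δ < |u z.2 - u z.1|},
    ENNReal.ofReal (δ ^ p / ‖z.1 - z.2‖ ^ ((N : ℝ) + p))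

/-- `u` is radially symmetric and decreasing (in the wide sense): up to a null set,
`u(x) = f(|x|)` with `f` non-increasing on `(0, ∞)`. The value at the origin plays no role,
so that `u` may be unbounded near the origin. -/
def IsRadiallyDecreasing {N : ℕ} (u : EuclideanSpace ℝ (Fin N) → ℝ) : Prop :=
  ∃ f : ℝ → ℝ, AntitoneOn f (Set.Ioi 0) ∧ u =ᵐ[volume] fun x => f ‖x‖

/-- The sequence `u` lies in `L^q(μ)` and is bounded there. -/
def IsBoundedInLp {α : Type*} [MeasurableSpace α] (μ : Measure α) (q : ℝ≥0∞) (u : ℕ → α → ℝ) :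
    Prop :=
  (∀ n, MemLp (u n) q μ) ∧ ∃ C : ℝ≥0, ∀ n, eLpNorm (u n) q μ ≤ C

/-- The sequence `u` lies in `L^q(μ)`, `q ≥ 1`, and its range is relatively compact there for the
norm topology. (`Fact (1 ≤ q)` is what makes `Lp` a normed space; it is part of the assertion.) -/
def IsPrecompactInLp {α : Type*} [MeasurableSpace α] (μ : Measure α) (q : ℝ≥0∞)
    (u : ℕ → α → ℝ) : Prop :=
  ∃ (_ : Fact (1 ≤ q)) (h : ∀ n, MemLp (u n) q μ),
    IsCompact (closure (Set.range fun n => ((h n).toLp (u n) : Lp ℝ q μ)))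

/-! Once the radial profiles lie under one radial majorant in $L^r$, compactness is soft: Helly's
theorem gives a.e. convergent subsequences, and domination turns a.e. convergence into norm
convergence. So the content is two pointwise bounds on the profiles $f$, which are nonnegative
because they lie in $L^p$.

At infinity, monotonicity and the $L^p$ bound give $f(t)\le Bt^{-N/p}$, which is in $L^r$ there
since $r>p$. Near the origin one needs $f(t)\le At^{-(N-p)/p}$, which is in $L^r$ there since
$r<Np/(N-p)$.

The bound near the origin comes from the energy through `shellConst_mul_le_energy`:
$(f(s)-f(2s)-\delta)^p s^{N-p}\lesssim I_\delta$ whenever $f(s)-f(2s)>\delta$. Cut $[s,2s]$ at radii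
where $f$ has dropped by successive multiples of $\delta$. Close points on opposite sides of a gap
of width $w$ have values differing by more than $\delta$, and contribute at least about $\delta^p
s^{N-1}w^{1-p}$. These sets of pairs overlap at most three times and the $K$ widths sum to at most
$s$, so convexity yields a total of order $(K\delta)^p s^{N-p}$. Iterating over dyadic scales
(`exists_growth_bound_of_doubling`) sums a geometric series. -/

/-! ### Compactness from monotonicity and domination -/

/-- **Helly's selection theorem** for antitone functions on the line: a pointwise bounded sequence
has a subsequence that converges outside a countable set. -/
theorem exists_subseq_tendsto_of_antitone {h : ℕ → ℝ → ℝ} (hh : ∀ n, Antitone (h n)) {B : ℝ → ℝ}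
    (hB : ∀ n x, |h n x| ≤ B x) :
    ∃ φ : ℕ → ℕ, StrictMono φ ∧ ∃ (F : ℝ → ℝ) (C : Set ℝ), C.Countable ∧
      ∀ x ∉ C, Tendsto (fun n => h (φ n) x) atTop (𝓝 (F x)) := by
  have hK : IsCompact (Set.univ.pi fun q : ℚ => Set.Icc (-B q) (B q)) :=
    isCompact_univ_pi fun q => isCompact_Icc
  obtain ⟨g, -, φ, hφ, hg⟩ := hK.tendsto_subseq (x := fun n (q : ℚ) => h n q)
    (fun n q _ => abs_le.1 (hB n q))
  have hg' : ∀ q : ℚ, Tendsto (fun n => h (φ n) q) atTop (𝓝 (g q)) := fun q =>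
    (tendsto_pi_nhds.1 hg) q
  have hganti : Antitone g := fun q q' hqq => le_of_tendsto_of_tendsto' (hg' q') (hg' q)
    fun n => hh _ (by exact_mod_cast hqq)
  -- Extends the limit on the rationals to an antitone function on the line, hence continuous off a
  -- countable set. At a continuity point, rationals on either side squeeze the sequence.
  set F : ℝ → ℝ := fun x => sInf (g '' {q : ℚ | (q : ℝ) < x}) with hF
  have hne : ∀ x : ℝ, (g '' {q : ℚ | (q : ℝ) < x}).Nonempty := fun x =>
    Set.Nonempty.image g (exists_rat_lt x)
  have hbdd : ∀ x : ℝ, BddBelow (g '' {q : ℚ | (q : ℝ) < x}) := fun x => by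
    obtain ⟨q', hq'⟩ := exists_rat_gt x
    refine ⟨g q', ?_⟩
    rintro _ ⟨q, hq, rfl⟩
    exact hganti (by exact_mod_cast (lt_trans hq hq').le)
  have hFanti : Antitone F := fun x y hxy => csInf_le_csInf (hbdd y) (hne x)
    (Set.image_mono fun q (hq : (q : ℝ) < x) => lt_of_lt_of_le hq hxy)
  have hFle : ∀ (q : ℚ) (x : ℝ), (q : ℝ) < x → F x ≤ g q := fun q x hq =>
    csInf_le (hbdd x) ⟨q, hq, rfl⟩
  have hleF : ∀ (q : ℚ) (x : ℝ), x ≤ q → g q ≤ F x := fun q x hq => by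
    refine le_csInf (hne x) ?_
    rintro _ ⟨q', hq', rfl⟩
    exact hganti (by exact_mod_cast (lt_of_lt_of_le hq' hq).le)
  refine ⟨φ, hφ, F, _, hFanti.countable_not_continuousAt, fun x hx => ?_⟩
  have hx : ContinuousAt F x := by simpa using hx
  refine tendsto_order.2 ⟨fun a ha => ?_, fun a ha => ?_⟩
  · obtain ⟨y, hxy, hy⟩ : ∃ y, x < y ∧ ∀ z ∈ Set.Ico x y, a < F z := by
      obtain ⟨y, hy, hy'⟩ := exists_Ico_subset_of_mem_nhds (hx.eventually (lt_mem_nhds ha))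
        (exists_gt x)
      exact ⟨y, hy, hy'⟩
    obtain ⟨q, hq, hqy⟩ := exists_rat_btwn hxy
    obtain ⟨z, hz, hzy⟩ := exists_between hqy
    have : a < g q := (hy z ⟨(hq.trans hz).le, hzy⟩).trans_le (hFle q z hz)
    filter_upwards [(hg' q).eventually (lt_mem_nhds this)] with n hn
    exact hn.trans_le (hh _ hq.le)
  · obtain ⟨y, hxy, hy⟩ : ∃ y, y < x ∧ ∀ z ∈ Set.Ioc y x, F z < a := by
      obtain ⟨y, hy, hy'⟩ := exists_Ioc_subset_of_mem_nhds (hx.eventually (gt_mem_nhds ha))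
        (exists_lt x)
      exact ⟨y, hy, hy'⟩
    obtain ⟨q, hq, hqx⟩ := exists_rat_btwn hxy
    have : g q < a := (hleF q q le_rfl).trans_lt (hy q ⟨hq, hqx.le⟩)
    filter_upwards [(hg' q).eventually (gt_mem_nhds this)] with n hn
    exact (hh _ hqx.le).trans_lt hn

/-- If every sequence in the range of `x` has a convergent subsequence, then the range of `x` is
relatively compact. -/
theorem isCompact_closure_range_of_subseq {X : Type*} [PseudoMetricSpace X] {x : ℕ → X}
    (hx : ∀ σ : ℕ → ℕ, ∃ φ : ℕ → ℕ, StrictMono φ ∧ ∃ a, Tendsto (fun k => x (σ (φ k))) atTop (𝓝 a)) :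
    IsCompact (closure (Set.range x)) := by
  refine isCompact_iff_isSeqCompact.2 fun y hy => ?_
  -- A sequence in the closure is shadowed by points of the range at vanishing distance; the chosen
  -- indices need not increase, so `hx` allows arbitrary `σ`.
  have : ∀ k : ℕ, ∃ m, dist (y k) (x m) < 1 / ((k : ℝ) + 1) := fun k => by
    obtain ⟨_, ⟨m, rfl⟩, hm⟩ := Metric.mem_closure_iff.1 (hy k) (1 / ((k : ℝ) + 1)) (by positivity)
    exact ⟨m, hm⟩
  choose σ hσ using this
  obtain ⟨φ, hφ, a, ha⟩ := hx σ
  have hlim : Tendsto (y ∘ φ) atTop (𝓝 a) := by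
    refine (tendsto_iff_of_dist ?_).2 ha
    refine squeeze_zero (fun _ => dist_nonneg) (fun k => (hσ (φ k)).le) ?_
    exact tendsto_one_div_add_atTop_nhds_zero_nat.comp hφ.tendsto_atTop
  exact ⟨a, isClosed_closure.mem_of_tendsto hlim (Eventually.of_forall fun k => hy _), φ, hφ, hlim⟩

/-- Dominated convergence in `L^q`. -/
theorem tendsto_eLpNorm_sub_of_dominated {α : Type*} [MeasurableSpace α] {μ : Measure α} {q : ℝ≥0∞}
    (hq0 : q ≠ 0) (hq : q ≠ ∞) {v : ℕ → α → ℝ} {g G : α → ℝ}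
    (hv : ∀ n, AEStronglyMeasurable (v n) μ) (hG : MemLp G q μ)
    (hvG : ∀ n, ∀ᵐ x ∂μ, |v n x| ≤ G x)
    (hlim : ∀ᵐ x ∂μ, Tendsto (fun n => v n x) atTop (𝓝 (g x))) :
    MemLp g q μ ∧ Tendsto (fun n => eLpNorm (v n - g) q μ) atTop (𝓝 0) := by
  have hg : AEStronglyMeasurable g μ := aestronglyMeasurable_of_tendsto_ae atTop hv hlim
  have hgG : ∀ᵐ x ∂μ, |g x| ≤ G x := by
    filter_upwards [hlim, ae_all_iff.2 hvG] with x hx hxG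
    exact le_of_tendsto hx.abs (Eventually.of_forall hxG)
  have hq' : 0 < q.toReal := ENNReal.toReal_pos hq0 hq
  refine ⟨hG.mono' hg hgG, ?_⟩
  have key : Tendsto (fun n => ∫⁻ x, ‖(v n - g) x‖ₑ ^ q.toReal ∂μ) atTop (𝓝 (∫⁻ _, 0 ∂μ)) := by
    refine tendsto_lintegral_of_dominated_convergence' (fun x => ‖(2 * G x : ℝ)‖ₑ ^ q.toReal)
      (fun n => ((hv n).sub hg).enorm.pow_const _) (fun n => ?_) ?_ ?_
    · filter_upwards [hvG n, hgG] with x h1 h2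
      refine ENNReal.rpow_le_rpow ?_ hq'.le
      rw [enorm_le_iff_norm_le, Real.norm_eq_abs, Real.norm_eq_abs, Pi.sub_apply]
      refine le_trans ?_ (le_abs_self _)
      linarith [abs_sub (v n x) (g x)]
    · have := (hG.const_mul 2).eLpNorm_lt_top
      exact (lintegral_rpow_enorm_lt_top_of_eLpNorm_lt_top hq0 hq this).ne
    · filter_upwards [hlim] with x hx
      have h1 : Tendsto (fun n => ‖(v n - g) x‖ₑ) atTop (𝓝 0) := by
        have : Tendsto (fun n => ‖v n x - g x‖ₑ) atTop (𝓝 ‖g x - g x‖ₑ) :=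
          (hx.sub_const (g x)).enorm
        simpa using this
      have h2 := (ENNReal.continuous_rpow_const (y := q.toReal)).continuousAt.tendsto.comp h1
      simpa [Function.comp_def, ENNReal.zero_rpow_of_pos hq'] using h2
  have := (ENNReal.continuous_rpow_const (y := 1 / q.toReal)).continuousAt.tendsto.comp key
  simp only [lintegral_zero, ENNReal.zero_rpow_of_pos (one_div_pos.2 hq')] at this
  refine this.congr fun n => ?_
  rw [eLpNorm_eq_lintegral_rpow_enorm_toReal hq0 hq]
  rfl

theorem isPrecompactInLp_of_dominated {α : Type*} [MeasurableSpace α] {μ : Measure α} {q : ℝ≥0∞}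
    (hq1 : 1 ≤ q) (hq : q ≠ ∞) {u : ℕ → α → ℝ} {G : α → ℝ}
    (hu : ∀ n, AEStronglyMeasurable (u n) μ) (hG : MemLp G q μ)
    (huG : ∀ n, ∀ᵐ x ∂μ, |u n x| ≤ G x)
    (hsub : ∀ σ : ℕ → ℕ, ∃ φ : ℕ → ℕ, StrictMono φ ∧ ∃ g : α → ℝ,
      ∀ᵐ x ∂μ, Tendsto (fun k => u (σ (φ k)) x) atTop (𝓝 (g x))) :
    IsPrecompactInLp μ q u := by
  have hmem : ∀ n, MemLp (u n) q μ := fun n => hG.mono' (hu n) (huG n)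
  refine ⟨⟨hq1⟩, hmem, ?_⟩
  have : Fact (1 ≤ q) := ⟨hq1⟩
  refine isCompact_closure_range_of_subseq fun σ => ?_
  obtain ⟨φ, hφ, g, hg⟩ := hsub σ
  obtain ⟨hgm, hlim⟩ := tendsto_eLpNorm_sub_of_dominated (zero_lt_one.trans_le hq1).ne' hq
    (fun k => hu (σ (φ k))) hG (fun k => huG _) hg
  exact ⟨φ, hφ, hgm.toLp g, (Lp.tendsto_Lp_iff_tendsto_eLpNorm'' _ _ _ _).2 hlim⟩

/-- A countable set of radii is negligible. -/
theorem ae_norm_notMem_of_countable {E : Type*} [NormedAddCommGroup E] [NormedSpace ℝ E]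
    [MeasurableSpace E] [BorelSpace E] [FiniteDimensional ℝ E] [Nontrivial E] (μ : Measure E)
    [μ.IsAddHaarMeasure] {C : Set ℝ} (hC : C.Countable) : ∀ᵐ x ∂μ, ‖x‖ ∉ C := by
  have : ∀ᵐ x ∂μ, ∀ c ∈ C, ‖x‖ ≠ c := by
    refine (ae_ball_iff hC).2 fun c _ => ?_
    have h := Measure.addHaar_sphere μ (0 : E) c
    rw [measure_eq_zero_iff_ae_notMem] at h
    filter_upwards [h] with x hx hxc
    exact hx (by simpa using hxc)
  filter_upwards [this] with x hx hxC
  exact hx _ hxC rfl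

/-- A sequence of radially decreasing profiles with a common majorant has an a.e. convergent
subsequence. -/
theorem exists_subseq_ae_tendsto_radial {E : Type*} [NormedAddCommGroup E] [NormedSpace ℝ E]
    [MeasurableSpace E] [BorelSpace E] [FiniteDimensional ℝ E] [Nontrivial E] (μ : Measure E)
    [μ.IsAddHaarMeasure] {f : ℕ → ℝ → ℝ} (hf : ∀ n, AntitoneOn (f n) (Set.Ioi 0)) {B : ℝ → ℝ}
    (hB : ∀ n, ∀ t > 0, |f n t| ≤ B t) :
    ∃ φ : ℕ → ℕ, StrictMono φ ∧ ∃ g : E → ℝ,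
      ∀ᵐ x ∂μ, Tendsto (fun k => f (φ k) ‖x‖) atTop (𝓝 (g x)) := by
  -- The substitution $t\mapsto e^t$ turns monotonicity on $(0,\infty)$ into monotonicity on the
  -- whole line.
  obtain ⟨φ, hφ, F, C, hC, hF⟩ := exists_subseq_tendsto_of_antitone
    (h := fun n t => f n (Real.exp t))
    (fun n s t hst => hf n (Real.exp_pos s) (Real.exp_pos t) (Real.exp_le_exp.2 hst))
    (B := fun t => B (Real.exp t)) (fun n t => hB n _ (Real.exp_pos t))
  refine ⟨φ, hφ, fun x => F (Real.log ‖x‖), ?_⟩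
  filter_upwards [ae_norm_notMem_of_countable μ ((hC.image Real.exp).insert 0)] with x hx
  have h0 : 0 < ‖x‖ := lt_of_le_of_ne (norm_nonneg x) fun h => hx (Or.inl h.symm)
  have h1 : Real.log ‖x‖ ∉ C := fun h => hx (Or.inr ⟨_, h, Real.exp_log h0⟩)
  simpa [Real.exp_log h0] using hF _ h1

/-! ### Energy across one thin shell -/

/-- Pairs of points that are close to each other, on the two sides of the shell `a ≤ ‖x‖ ≤ b`. -/
def shellPairs (E : Type*) [NormedAddCommGroup E] (a b w : ℝ) : Set (E × E) :=
  {z | (a - w < ‖z.1‖ ∧ ‖z.1‖ < a) ∧ (b < ‖z.2‖ ∧ ‖z.2‖ < b + w) ∧ ‖z.1 - z.2‖ ≤ 3 * w}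

section

variable {E : Type*} [NormedAddCommGroup E]

theorem measurableSet_shellPairs [MeasurableSpace E] [BorelSpace E] [SecondCountableTopology E]
    (a b w : ℝ) : MeasurableSet (shellPairs E a b w) := by
  have h1 : Measurable fun z : E × E => ‖z.1‖ := continuous_fst.norm.measurable
  have h2 : Measurable fun z : E × E => ‖z.2‖ := continuous_snd.norm.measurable
  have h3 : Measurable fun z : E × E => ‖z.1 - z.2‖ :=
    (continuous_fst.sub continuous_snd).norm.measurable
  exact ((measurableSet_lt measurable_const h1).inter (measurableSet_lt h1 measurable_const)).inter
    (((measurableSet_lt measurable_const h2).inter (measurableSet_lt h2 measurable_const)).inter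
      (measurableSet_le h3 measurable_const))

variable [NormedSpace ℝ E]

/-- The centre lies on the ray through `x`, in the middle of the outer shell. Its distance to `x` is
less than $(b-a)+3w/2\le 5w/2$, and the radius adds $w/2$: hence the factor 3 in `shellPairs`. -/
theorem ball_subset_shellPairs_section {a b w : ℝ} (hwa : w ≤ a) (hab : a ≤ b)
    (hbw : b - a ≤ w) {x : E} (hx : a - w < ‖x‖ ∧ ‖x‖ < a) :
    Metric.ball (((b + w / 2) / ‖x‖) • x) (w / 2) ⊆ Prod.mk x ⁻¹' shellPairs E a b w := by
  have hx0 : 0 < ‖x‖ := by linarith [hx.1]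
  set c := ((b + w / 2) / ‖x‖) • x with hc
  have hcn : ‖c‖ = b + w / 2 := by
    rw [hc, norm_smul, Real.norm_eq_abs, abs_of_pos (by apply div_pos <;> linarith),
      div_mul_cancel₀ _ hx0.ne']
  have hxc : ‖x - c‖ = b + w / 2 - ‖x‖ := by
    have : x - c = (-((b + w / 2 - ‖x‖) / ‖x‖)) • x := by
      rw [hc, sub_div, div_self hx0.ne']
      module
    rw [this, norm_smul, norm_neg, Real.norm_eq_abs,
      abs_of_nonneg (by apply div_nonneg <;> linarith [hx.2]), div_mul_cancel₀ _ hx0.ne']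
  intro y hy
  rw [Metric.mem_ball, dist_eq_norm] at hy
  have h1 : |‖y‖ - ‖c‖| ≤ ‖y - c‖ := abs_norm_sub_norm_le y c
  have h2 : ‖x - y‖ ≤ ‖x - c‖ + ‖y - c‖ := by
    rw [norm_sub_rev y c]
    exact norm_sub_le_norm_sub_add_norm_sub x c y
  rw [abs_le] at h1
  refine ⟨hx, ⟨?_, ?_⟩, ?_⟩ <;> dsimp only <;> linarith [hx.1]

variable [MeasurableSpace E] [BorelSpace E] [FiniteDimensional ℝ E] [Nontrivial E]
  (μ : Measure E) [μ.IsAddHaarMeasure]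

theorem le_measure_annulus {a w : ℝ} (hw : 0 < w) (hwa : w ≤ a) :
    ENNReal.ofReal (w * a ^ (Module.finrank ℝ E - 1)) * μ (Metric.ball 0 1) ≤
      μ {x : E | a - w < ‖x‖ ∧ ‖x‖ < a} := by
  have hset : {x : E | a - w < ‖x‖ ∧ ‖x‖ < a} = Metric.ball 0 a \ Metric.closedBall 0 (a - w) := by
    ext x
    simp [and_comm]
  have hd : Module.finrank ℝ E = Module.finrank ℝ E - 1 + 1 :=
    (Nat.sub_add_cancel Module.finrank_pos).symm
  rw [hset, measure_sdiff (fun x hx => by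
      rw [mem_closedBall_zero_iff] at hx
      rw [mem_ball_zero_iff]
      linarith) measurableSet_closedBall.nullMeasurableSet measure_closedBall_lt_top.ne,
    Measure.addHaar_ball μ _ (by linarith : 0 ≤ a), Measure.addHaar_closedBall μ _ (by linarith),
    ← ENNReal.sub_mul (fun _ _ => measure_ball_lt_top.ne),
    ← ENNReal.ofReal_sub _ (by apply pow_nonneg; linarith)]
  gcongr
  -- Reduces to $a^d-(a-w)^d\ge a^{d-1}(a-(a-w))=wa^{d-1}$.
  rw [hd, Nat.add_sub_cancel, pow_succ, pow_succ]
  have : (a - w) ^ (Module.finrank ℝ E - 1) ≤ a ^ (Module.finrank ℝ E - 1) :=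
    pow_le_pow_left₀ (by linarith) (by linarith) _
  nlinarith

/-- Fubini: each point of the inner annulus has a section containing a ball of radius $w/2$. -/
theorem le_measure_shellPairs {a b w : ℝ} (hw : 0 < w) (hwa : w ≤ a) (hab : a ≤ b)
    (hbw : b - a ≤ w) :
    ENNReal.ofReal ((w / 2) ^ Module.finrank ℝ E) * μ (Metric.ball 0 1) *
        (ENNReal.ofReal (w * a ^ (Module.finrank ℝ E - 1)) * μ (Metric.ball 0 1)) ≤
      (μ.prod μ) (shellPairs E a b w) := by
  have hmeas : MeasurableSet {x : E | a - w < ‖x‖ ∧ ‖x‖ < a} :=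
    (measurableSet_lt measurable_const continuous_norm.measurable).inter
      (measurableSet_lt continuous_norm.measurable measurable_const)
  rw [Measure.prod_apply (measurableSet_shellPairs a b w)]
  calc _ ≤ ENNReal.ofReal ((w / 2) ^ Module.finrank ℝ E) * μ (Metric.ball 0 1) *
        μ {x : E | a - w < ‖x‖ ∧ ‖x‖ < a} := by
        gcongr
        exact le_measure_annulus μ hw hwa
    _ = ∫⁻ x in {x : E | a - w < ‖x‖ ∧ ‖x‖ < a},
        ENNReal.ofReal ((w / 2) ^ Module.finrank ℝ E) * μ (Metric.ball 0 1) ∂μ := by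
        rw [setLIntegral_const]
    _ ≤ ∫⁻ x in {x : E | a - w < ‖x‖ ∧ ‖x‖ < a}, μ (Prod.mk x ⁻¹' shellPairs E a b w) ∂μ := by
        refine setLIntegral_mono' hmeas fun x hx => ?_
        rw [← Measure.addHaar_ball μ (((b + w / 2) / ‖x‖) • x) (by linarith : 0 ≤ w / 2)]
        exact measure_mono (ball_subset_shellPairs_section hwa hab hbw hx)
    _ ≤ _ := setLIntegral_le_lintegral _ _

/-- Interaction energy across a thin shell. -/
theorem le_setLIntegral_shellPairs {a b w p c : ℝ} (hp : 0 ≤ p) (hc : 0 ≤ c) (hw : 0 < w)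
    (hwa : w ≤ a) (hab : a ≤ b) (hbw : b - a ≤ w) :
    μ (Metric.ball 0 1) ^ 2 *
        ENNReal.ofReal (3 ^ (-((Module.finrank ℝ E : ℝ) + p)) / 2 ^ Module.finrank ℝ E) *
        ENNReal.ofReal (c * a ^ (Module.finrank ℝ E - 1) * w ^ (1 - p)) ≤
      ∫⁻ z in shellPairs E a b w,
        ENNReal.ofReal (c / ‖z.1 - z.2‖ ^ ((Module.finrank ℝ E : ℝ) + p)) ∂(μ.prod μ) := by
  set d := Module.finrank ℝ E
  calc _ = ENNReal.ofReal (c / (3 * w) ^ ((d : ℝ) + p)) *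
        (ENNReal.ofReal ((w / 2) ^ d) * μ (Metric.ball 0 1) *
        (ENNReal.ofReal (w * a ^ (d - 1)) * μ (Metric.ball 0 1))) := by
        have h1 : c / (3 * w) ^ ((d : ℝ) + p) * ((w / 2) ^ d * (w * a ^ (d - 1))) =
            3 ^ (-((d : ℝ) + p)) / 2 ^ d * (c * a ^ (d - 1) * w ^ (1 - p)) := by
          rw [Real.mul_rpow (by norm_num) hw.le, Real.rpow_neg (by norm_num), Real.rpow_add hw,
            Real.rpow_sub hw, Real.rpow_one, Real.rpow_natCast, div_pow]
          have := (Real.rpow_pos_of_pos hw p).ne'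
          have := (Real.rpow_pos_of_pos (by norm_num : (0 : ℝ) < 3) ((d : ℝ) + p)).ne'
          field_simp
        have ha : 0 ≤ a := by linarith
        rw [mul_assoc, ← ENNReal.ofReal_mul (by positivity), ← h1,
          ENNReal.ofReal_mul (by positivity), ENNReal.ofReal_mul (by positivity)]
        ring
    _ ≤ ENNReal.ofReal (c / (3 * w) ^ ((d : ℝ) + p)) * (μ.prod μ) (shellPairs E a b w) := by
        gcongr
        exact le_measure_shellPairs μ hw hwa hab hbw
    _ = ∫⁻ z in shellPairs E a b w, ENNReal.ofReal (c / (3 * w) ^ ((d : ℝ) + p)) ∂(μ.prod μ) := by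
        rw [setLIntegral_const]
    _ ≤ _ := by
        refine setLIntegral_mono' (measurableSet_shellPairs a b w) fun z hz => ?_
        obtain ⟨h1, h2, h3⟩ := hz
        have h4 : 0 < ‖z.1 - z.2‖ := by
          have := norm_sub_norm_le z.2 z.1
          rw [norm_sub_rev] at this
          linarith [h1.2, h2.1]
        gcongr

end

/-! ### Gaps between level radii: convexity, overlap and construction -/

/-- A Jensen-type inequality: `K` positive numbers of sum at most `L` satisfy
`K ^ p ≤ 2 ^ p L ^ (p - 1) ∑ w ^ (1 - p)`. -/
theorem rpow_le_mul_sum_rpow_one_sub {K : ℕ} (hK : 0 < K) {w : ℕ → ℝ} {L p : ℝ} (hL : 0 < L)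
    (hp : 1 ≤ p) (hw : ∀ k ∈ Finset.range K, 0 < w k) (hsum : ∑ k ∈ Finset.range K, w k ≤ L) :
    (K : ℝ) ^ p ≤ 2 ^ p * L ^ (p - 1) * ∑ k ∈ Finset.range K, w k ^ (1 - p) := by
  have hK' : (0 : ℝ) < K := by exact_mod_cast hK
  -- Twice the largest possible mean, so the terms `w k / W` sum to at most $K/2$ and the other half
  -- of $K$ must come from the powers.
  set W : ℝ := 2 * L / K with hW
  have hW0 : 0 < W := by positivity
  have hterm : ∀ k ∈ Finset.range K, 1 ≤ W ^ (p - 1) * w k ^ (1 - p) + w k / W := fun k hk => by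
    have hwk := hw k hk
    rcases le_total (w k) W with h | h
    · have : 1 ≤ W ^ (p - 1) * w k ^ (1 - p) := by
        rw [show 1 - p = -(p - 1) by ring, Real.rpow_neg hwk.le, ← div_eq_mul_inv,
          one_le_div (by positivity)]
        exact Real.rpow_le_rpow hwk.le h (by linarith)
      have : 0 ≤ w k / W := by positivity
      linarith
    · have : 1 ≤ w k / W := (one_le_div hW0).2 h
      have : 0 ≤ W ^ (p - 1) * w k ^ (1 - p) := by positivity
      linarith
  have h1 := Finset.sum_le_sum hterm
  rw [Finset.sum_const, Finset.card_range, nsmul_eq_mul, mul_one, Finset.sum_add_distrib,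
    ← Finset.mul_sum, ← Finset.sum_div] at h1
  set S := ∑ k ∈ Finset.range K, w k ^ (1 - p)
  have h2 : (∑ k ∈ Finset.range K, w k) / W ≤ K / 2 := by
    rw [div_le_iff₀ hW0, hW]
    field_simp
    linarith
  have h3 : (K : ℝ) / 2 ≤ W ^ (p - 1) * S := by linarith
  have h4 : W ^ (p - 1) = 2 ^ (p - 1) * L ^ (p - 1) / (K : ℝ) ^ (p - 1) := by
    rw [hW, Real.div_rpow (by positivity) hK'.le, Real.mul_rpow (by norm_num) hL.le]
  have hKp : (K : ℝ) ^ p = (K : ℝ) ^ (p - 1) * K := by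
    rw [← Real.rpow_add_one hK'.ne']; ring_nf
  have h2p : (2 : ℝ) ^ p = 2 ^ (p - 1) * 2 := by
    rw [← Real.rpow_add_one (by norm_num)]; ring_nf
  rw [h4, div_mul_eq_mul_div, le_div_iff₀ (by positivity)] at h3
  rw [hKp, h2p]
  linarith

/-- The gaps of a monotone sequence that lie within `[a, b]` have total length at most `b - a`. -/
theorem sum_gaps_le {t : ℕ → ℝ} (ht : Monotone t) {a b : ℝ} (hab : a ≤ b) (K : ℕ) (P : ℕ → Prop)
    [DecidablePred P] (hP : ∀ k, P k → a ≤ t k ∧ t (k + 1) ≤ b) :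
    ∑ k ∈ Finset.range K, (if P k then t (k + 1) - t k else 0) ≤ b - a := by
  -- Clamping to $[a,b]$ keeps the selected gaps intact and makes the full sum telescope.
  set ψ : ℝ → ℝ := fun x => max a (min b x) with hψ
  have hmono : Monotone ψ := fun x y hxy => max_le_max le_rfl (min_le_min le_rfl hxy)
  calc _ ≤ ∑ k ∈ Finset.range K, (ψ (t (k + 1)) - ψ (t k)) := by
        refine Finset.sum_le_sum fun k _ => ?_
        have hk := ht (Nat.le_succ k)
        split_ifs with h
        · obtain ⟨h1, h2⟩ := hP k h
          simp only [Nat.succ_eq_add_one] at hk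
          simp only [hψ]
          rw [min_eq_right h2, min_eq_right (hk.trans h2), max_eq_right h1,
            max_eq_right (h1.trans hk)]
        · exact sub_nonneg.2 (hmono hk)
    _ = ψ (t K) - ψ (t 0) := Finset.sum_range_sub (fun k => ψ (t k)) K
    _ ≤ b - a := by
        have h1 : ψ (t K) ≤ b := max_le hab (min_le_left _ _)
        have h2 : a ≤ ψ (t 0) := le_max_left _ _
        linarith

section

variable {E : Type*} [NormedAddCommGroup E]

/-- The sets of close pairs attached to the consecutive gaps of a monotone sequence overlap at most
three times. -/
theorem sum_indicator_shellPairs_le {t : ℕ → ℝ} (ht : Monotone t) (K : ℕ) (z : E × E) :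
    ∑ k ∈ Finset.range K,
      (shellPairs E (t k) (t (k + 1)) (t (k + 1) - t k)).indicator (fun _ => (1 : ℝ≥0∞)) z ≤ 3 := by
  classical
  set P : ℕ → Prop := fun k => z ∈ shellPairs E (t k) (t (k + 1)) (t (k + 1) - t k) with hP
  have hind : ∀ k, (shellPairs E (t k) (t (k + 1)) (t (k + 1) - t k)).indicator
      (fun _ => (1 : ℝ≥0∞)) z = if P k then 1 else 0 := fun k => Set.indicator_apply _ _ _
  simp only [hind, Finset.sum_boole]
  by_cases hex : ∃ k, P k
  -- Each gap met by `z` lies in $[\|z_1\|,\|z_2\|]$ and is at least $\|z_1-z_2\|/3$ long, while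
  -- their total length is at most $\|z_2\|-\|z_1\|\le\|z_1-z_2\|$.
  · obtain ⟨k₀, h1, h2, -⟩ := hex
    have hk₀ : t k₀ ≤ t (k₀ + 1) := ht (Nat.le_succ _)
    have hab : ‖z.1‖ < ‖z.2‖ := by linarith [h1.2, h2.1]
    have hsum := sum_gaps_le ht hab.le K P fun k hk => ⟨hk.1.2.le, hk.2.1.1.le⟩
    have hl : ‖z.2‖ - ‖z.1‖ ≤ ‖z.1 - z.2‖ := by
      rw [norm_sub_rev]
      exact norm_sub_norm_le _ _
    have h3 : ∑ k ∈ Finset.range K, (if P k then ‖z.1 - z.2‖ else 0) ≤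
        ∑ k ∈ Finset.range K, 3 * (if P k then t (k + 1) - t k else 0) := by
      refine Finset.sum_le_sum fun k _ => ?_
      split_ifs with h
      · exact h.2.2
      · simp
    rw [← Finset.mul_sum, ← Finset.sum_filter, Finset.sum_const, nsmul_eq_mul] at h3
    have h4 : (((Finset.range K).filter P).card : ℝ) ≤ 3 := by
      have : (((Finset.range K).filter P).card : ℝ) * ‖z.1 - z.2‖ ≤ 3 * ‖z.1 - z.2‖ := by linarith
      exact le_of_mul_le_mul_right this (by linarith)
    have h5 : ((Finset.range K).filter P).card ≤ 3 := by exact_mod_cast h4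
    exact_mod_cast h5
  · push Not at hex
    simp [hex]

end

/-- Level points of a decreasing profile: the radii at which the profile has dropped by
multiples of `δ`. -/
theorem exists_level_radii {g : ℝ → ℝ} (hg : AntitoneOn g (Set.Ioi 0)) {s δ : ℝ} (hs : 0 < s)
    (hδ : 0 < δ) {K : ℕ} (hK : K * δ < g s - g (2 * s)) :
    ∃ t : ℕ → ℝ, Monotone t ∧ s ≤ t 0 ∧ t K ≤ 2 * s ∧ ∀ k < K, ∀ x y, 0 < x → x < t k →
      t (k + 1) < y → δ < g x - g y := by
  -- Capping the index at `K` keeps every level above $g(2s)$, so every `A k` is bounded by $2s$ and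
  -- the suprema form a monotone sequence on all of `ℕ`.
  set A : ℕ → Set ℝ := fun k => {τ | 0 < τ ∧ g s - (min k K : ℕ) * δ ≤ g τ} with hA
  have hsA : ∀ k, s ∈ A k := fun k => ⟨hs, by
    have : 0 ≤ ((min k K : ℕ) : ℝ) * δ := by positivity
    linarith⟩
  have hbd : ∀ k, ∀ τ ∈ A k, τ ≤ 2 * s := fun k τ hτ => by
    by_contra! h
    have h1 := hg (Set.mem_Ioi.2 (by linarith : 0 < 2 * s)) (Set.mem_Ioi.2 hτ.1) h.le
    have h2 : ((min k K : ℕ) : ℝ) * δ ≤ K * δ := by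
      gcongr
      exact min_le_right _ _
    linarith [hτ.2]
  have hbdd : ∀ k, BddAbove (A k) := fun k => ⟨2 * s, hbd k⟩
  refine ⟨fun k => sSup (A k), ?_, le_csSup (hbdd 0) (hsA 0), csSup_le ⟨s, hsA K⟩ (hbd K), ?_⟩
  · intro k l hkl
    refine csSup_le_csSup (hbdd l) ⟨s, hsA k⟩ fun τ hτ => ⟨hτ.1, ?_⟩
    have : ((min k K : ℕ) : ℝ) * δ ≤ (min l K : ℕ) * δ := by
      gcongr
    linarith [hτ.2]
  · intro k hk x y hx hxt hty
    have hy : 0 < y := lt_of_lt_of_le hs ((le_csSup (hbdd _) (hsA (k + 1))).trans hty.le)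
    obtain ⟨τ, hτ, hxτ⟩ := exists_lt_of_lt_csSup ⟨s, hsA k⟩ hxt
    have h1 := hg (Set.mem_Ioi.2 hx) (Set.mem_Ioi.2 hτ.1) hxτ.le
    have h2 : y ∉ A (k + 1) := fun h => absurd (le_csSup (hbdd _) h) (not_le.2 hty)
    have h3 : g y < g s - (min (k + 1) K : ℕ) * δ := by
      by_contra! h
      exact h2 ⟨hy, h⟩
    have h4 := hτ.2
    rw [min_eq_left hk.le] at h4
    rw [min_eq_left (Nat.succ_le_of_lt hk)] at h3
    push_cast at h3
    linarith

/-! ### From the energy to the drop over a dyadic shell -/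

section

variable {E : Type*} [NormedAddCommGroup E] [NormedSpace ℝ E]
  [MeasurableSpace E] [BorelSpace E] [FiniteDimensional ℝ E] [Nontrivial E]
  (μ : Measure E) [μ.IsAddHaarMeasure]

/-- The constant of `le_setLIntegral_shellPairs`. -/
noncomputable def shellConst (p : ℝ) : ℝ≥0∞ :=
  μ (Metric.ball 0 1) ^ 2 *
    ENNReal.ofReal (3 ^ (-((Module.finrank ℝ E : ℝ) + p)) / 2 ^ Module.finrank ℝ E)

theorem shellConst_ne_zero (p : ℝ) : shellConst μ p ≠ 0 :=
  mul_ne_zero (pow_ne_zero _ (Metric.measure_ball_pos μ 0 one_pos).ne')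
    (ENNReal.ofReal_pos.2 (by positivity)).ne'

theorem shellConst_ne_top (p : ℝ) : shellConst μ p ≠ ∞ :=
  ENNReal.mul_ne_top (ENNReal.pow_ne_top measure_ball_lt_top.ne) ENNReal.ofReal_ne_top

/-- The energy is infinite across a jump. -/
theorem setLIntegral_eq_top_of_jump {p c a : ℝ} (hp : 1 < p) (hc : 0 < c) (ha : 0 < a)
    {D : Set (E × E)} (hD : ∀ w, 0 < w → w ≤ a → shellPairs E a a w ⊆ D) :
    ∫⁻ z in D, ENNReal.ofReal (c / ‖z.1 - z.2‖ ^ ((Module.finrank ℝ E : ℝ) + p)) ∂(μ.prod μ) =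
      ∞ := by
  set J := ∫⁻ z in D, ENNReal.ofReal (c / ‖z.1 - z.2‖ ^ ((Module.finrank ℝ E : ℝ) + p)) ∂(μ.prod μ)
  have hle : ∀ w, 0 < w → w ≤ a → shellConst μ p *
      ENNReal.ofReal (c * a ^ (Module.finrank ℝ E - 1) * w ^ (1 - p)) ≤ J := fun w hw hwa =>
    (le_setLIntegral_shellPairs μ (by linarith) hc.le hw hwa le_rfl (by linarith)).trans
      (lintegral_mono_set (hD w hw hwa))
  -- At a jump the width `w` is free; since $p>1$, $w^{1-p}$ blows up as $w\to0$.
  have hlim : Tendsto (fun w : ℝ => shellConst μ p *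
      ENNReal.ofReal (c * a ^ (Module.finrank ℝ E - 1) * w ^ (1 - p))) (𝓝[>] 0) (𝓝 ∞) := by
    have h1 : Tendsto (fun w : ℝ => c * a ^ (Module.finrank ℝ E - 1) * w ^ (1 - p)) (𝓝[>] 0)
        atTop :=
      (tendsto_rpow_neg_nhdsGT_zero (by linarith : 1 - p < 0)).const_mul_atTop (by positivity)
    have h2 := ENNReal.Tendsto.const_mul (a := shellConst μ p)
      (ENNReal.tendsto_ofReal_atTop.comp h1) (Or.inl ENNReal.top_ne_zero)
    rwa [ENNReal.mul_top (shellConst_ne_zero μ p)] at h2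
  refine top_le_iff.1 (le_of_tendsto hlim ?_)
  filter_upwards [Ioc_mem_nhdsGT ha] with w hw
  exact hle w hw.1 hw.2

/-- Sum of the energies across the consecutive gaps of a monotone sequence. -/
theorem sum_gap_energy_le {p c : ℝ} (hp : 0 ≤ p) (hc : 0 ≤ c) {t : ℕ → ℝ} (ht : Monotone t) {K : ℕ}
    (hpos : ∀ k ∈ Finset.range K, 0 < t (k + 1) - t k)
    (hle : ∀ k ∈ Finset.range K, t (k + 1) - t k ≤ t k) {D : Set (E × E)}
    (hD : ∀ k ∈ Finset.range K, shellPairs E (t k) (t (k + 1)) (t (k + 1) - t k) ⊆ D) :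
    ∑ k ∈ Finset.range K, shellConst μ p *
        ENNReal.ofReal (c * t k ^ (Module.finrank ℝ E - 1) * (t (k + 1) - t k) ^ (1 - p)) ≤
      3 * ∫⁻ z in D,
        ENNReal.ofReal (c / ‖z.1 - z.2‖ ^ ((Module.finrank ℝ E : ℝ) + p)) ∂(μ.prod μ) := by
  set F : E × E → ℝ≥0∞ := fun z =>
    ENNReal.ofReal (c / ‖z.1 - z.2‖ ^ ((Module.finrank ℝ E : ℝ) + p)) with hF
  have hFm : Measurable F := by
    have h3 : Measurable fun z : E × E => ‖z.1 - z.2‖ :=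
      (continuous_fst.sub continuous_snd).norm.measurable
    exact ((h3.pow_const _).const_div c).ennreal_ofReal
  set S : ℕ → Set (E × E) := fun k => shellPairs E (t k) (t (k + 1)) (t (k + 1) - t k)
  have hS : ∀ k, MeasurableSet (S k) := fun k => measurableSet_shellPairs _ _ _
  calc _ ≤ ∑ k ∈ Finset.range K, ∫⁻ z in S k, F z ∂(μ.prod μ) :=
        Finset.sum_le_sum fun k hk => le_setLIntegral_shellPairs μ hp hc (hpos k hk) (hle k hk)
          (ht (Nat.le_succ k)) le_rfl
    _ = ∑ k ∈ Finset.range K, ∫⁻ z in D, (S k).indicator F z ∂(μ.prod μ) := by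
        refine Finset.sum_congr rfl fun k hk => ?_
        rw [lintegral_indicator (hS k), Measure.restrict_restrict (hS k),
          Set.inter_eq_left.2 (hD k hk)]
    _ = ∫⁻ z in D, ∑ k ∈ Finset.range K, (S k).indicator F z ∂(μ.prod μ) :=
        (lintegral_finsetSum _ fun k _ => hFm.indicator (hS k)).symm
    _ ≤ ∫⁻ z in D, 3 * F z ∂(μ.prod μ) := by
        refine lintegral_mono fun z => ?_
        calc _ = (∑ k ∈ Finset.range K, (S k).indicator (fun _ => (1 : ℝ≥0∞)) z) * F z := by
              rw [Finset.sum_mul]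
              refine Finset.sum_congr rfl fun k _ => ?_
              by_cases h : z ∈ S k <;> simp [h]
          _ ≤ 3 * F z := by
              gcongr
              exact sum_indicator_shellPairs_le ht K z
    _ = _ := lintegral_const_mul _ hFm

/-- The energy controls the drop of a decreasing profile over a dyadic shell. -/
theorem shellConst_mul_le_energy {p δ : ℝ} (hp : 1 < p) (hδ : 0 < δ) {g : ℝ → ℝ}
    (hg : AntitoneOn g (Set.Ioi 0)) {s : ℝ} (hs : 0 < s) (hδs : δ < g s - g (2 * s)) :
    shellConst μ p * ENNReal.ofReal ((g s - g (2 * s) - δ) ^ p * s ^ ((Module.finrank ℝ E : ℝ) - p))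
      ≤ ENNReal.ofReal (2 ^ p) * (3 * ∫⁻ z in {z : E × E | δ < |g ‖z.2‖ - g ‖z.1‖|},
        ENNReal.ofReal (δ ^ p / ‖z.1 - z.2‖ ^ ((Module.finrank ℝ E : ℝ) + p)) ∂(μ.prod μ)) := by
  set d := Module.finrank ℝ E with hd
  set D := {z : E × E | δ < |g ‖z.2‖ - g ‖z.1‖|} with hDdef
  set J := ∫⁻ z in D, ENNReal.ofReal (δ ^ p / ‖z.1 - z.2‖ ^ ((d : ℝ) + p)) ∂(μ.prod μ) with hJ
  set M := g s - g (2 * s) with hM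
  -- The largest `K` with $K\delta<M$; then $K\delta\ge M-\delta$, which is why the estimate loses
  -- one `δ`.
  obtain ⟨K, hK1, hK2⟩ : ∃ K : ℕ, K * δ < M ∧ M ≤ (K + 1) * δ := by
    obtain ⟨n, hn⟩ : ∃ n, n = ⌈M / δ⌉₊ := ⟨_, rfl⟩
    have hMδ : 0 < M / δ := by apply div_pos <;> linarith
    have hn0 : 0 < n := hn ▸ Nat.ceil_pos.2 hMδ
    refine ⟨n - 1, ?_, ?_⟩
    · rw [← lt_div_iff₀ hδ]
      exact Nat.lt_ceil.1 (hn ▸ Nat.sub_lt hn0 one_pos)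
    · have h1 : ((n - 1 : ℕ) : ℝ) + 1 = n := by
        exact_mod_cast Nat.sub_add_cancel hn0
      rw [h1, ← div_le_iff₀ hδ, hn]
      exact Nat.le_ceil _
  have hK0 : 0 < K := by
    rcases Nat.eq_zero_or_pos K with h | h
    · rw [h] at hK2
      norm_num at hK2
      linarith
    · exact h
  obtain ⟨t, ht, ht0, htK, hlev⟩ := exists_level_radii hg hs hδ hK1
  have hst : ∀ k, s ≤ t k := fun k => ht0.trans (ht (Nat.zero_le k))
  have ht2 : ∀ k ∈ Finset.range K, t (k + 1) ≤ 2 * s := fun k hk =>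
    (ht (Nat.succ_le_of_lt (Finset.mem_range.1 hk))).trans htK
  have hsub : ∀ k ∈ Finset.range K, ∀ w ≤ t k, shellPairs E (t k) (t (k + 1)) w ⊆ D := by
    intro k hk w hw z hz
    have h := hlev k (Finset.mem_range.1 hk) ‖z.1‖ ‖z.2‖ (by linarith [hz.1.1]) hz.1.2 hz.2.1.1
    rw [hDdef, Set.mem_ofPred_eq, abs_sub_comm]
    exact h.trans_le (le_abs_self _)
  -- A vanishing gap means that `g` jumps by more than `δ` at a single radius, and then the energy
  -- is infinite.
  by_cases hpos : ∀ k ∈ Finset.range K, 0 < t (k + 1) - t k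
  · have hgap : ∀ k ∈ Finset.range K, t (k + 1) - t k ≤ t k := fun k hk => by
      linarith [ht2 k hk, hst k]
    have hE := sum_gap_energy_le μ (by linarith : (0 : ℝ) ≤ p) (Real.rpow_nonneg hδ.le p) ht hpos
      hgap fun k hk => hsub k hk _ (hgap k hk)
    have hsum : ∑ k ∈ Finset.range K, (t (k + 1) - t k) ≤ s := by
      rw [Finset.sum_range_sub]
      linarith
    have hJen := rpow_le_mul_sum_rpow_one_sub hK0 hs hp.le hpos hsum
    rw [← Finset.mul_sum, ← ENNReal.ofReal_sum_of_nonneg fun k hk => by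
      have := hpos k hk
      have := hs.trans_le (hst k)
      positivity] at hE
    calc _ ≤ shellConst μ p * ENNReal.ofReal (2 ^ p * ∑ k ∈ Finset.range K,
          δ ^ p * t k ^ (d - 1) * (t (k + 1) - t k) ^ (1 - p)) := by
          refine mul_le_mul' le_rfl (ENNReal.ofReal_le_ofReal ?_)
          have hd1 : s ^ ((d : ℝ) - p) * s ^ (p - 1) = s ^ (d - 1) := by
            rw [← Real.rpow_add hs, ← Real.rpow_natCast,
              Nat.cast_sub (Module.finrank_pos : 0 < Module.finrank ℝ E)]
            congr 1
            push_cast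
            ring
          calc (M - δ) ^ p * s ^ ((d : ℝ) - p) ≤ (K * δ) ^ p * s ^ ((d : ℝ) - p) := by
                gcongr
                linarith
            _ = (K : ℝ) ^ p * (δ ^ p * s ^ ((d : ℝ) - p)) := by
                rw [Real.mul_rpow (by positivity) hδ.le]
                ring
            _ ≤ (2 ^ p * s ^ (p - 1) * ∑ k ∈ Finset.range K, (t (k + 1) - t k) ^ (1 - p)) *
                  (δ ^ p * s ^ ((d : ℝ) - p)) := by gcongr
            _ = 2 ^ p * ∑ k ∈ Finset.range K,
                  δ ^ p * s ^ (d - 1) * (t (k + 1) - t k) ^ (1 - p) := by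
                rw [← Finset.mul_sum, ← hd1]
                ring
            _ ≤ _ := by
                gcongr with k hk
                · exact Real.rpow_nonneg (hpos k hk).le _
                · exact hst k
      _ = ENNReal.ofReal (2 ^ p) * (shellConst μ p * ENNReal.ofReal (∑ k ∈ Finset.range K,
          δ ^ p * t k ^ (d - 1) * (t (k + 1) - t k) ^ (1 - p))) := by
          rw [ENNReal.ofReal_mul (by positivity)]
          ring
      _ ≤ _ := by gcongr
  · push Not at hpos
    obtain ⟨k, hk, hk0⟩ := hpos
    have heq : t (k + 1) = t k := le_antisymm (by linarith) (ht (Nat.le_succ k))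
    have hJtop : J = ∞ := setLIntegral_eq_top_of_jump μ hp (Real.rpow_pos_of_pos hδ p)
      (hs.trans_le (hst k)) fun w _ hw => by
        have := hsub k hk w hw
        rwa [heq] at this
    rw [hJtop, ENNReal.mul_top (by norm_num), ENNReal.mul_top
      (ENNReal.ofReal_pos.2 (by positivity)).ne']
    exact le_top

end

/-! ### Pointwise growth bound near the origin -/

theorem nonlocalEnergy_congr_ae {N : ℕ} {p δ : ℝ} {u v : EuclideanSpace ℝ (Fin N) → ℝ}
    (huv : u =ᵐ[volume] v) : nonlocalEnergy p δ u = nonlocalEnergy p δ v := by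
  have h1 : ∀ᵐ z : EuclideanSpace ℝ (Fin N) × EuclideanSpace ℝ (Fin N), u z.1 = v z.1 :=
    Measure.quasiMeasurePreserving_fst.ae huv
  have h2 : ∀ᵐ z : EuclideanSpace ℝ (Fin N) × EuclideanSpace ℝ (Fin N), u z.2 = v z.2 :=
    Measure.quasiMeasurePreserving_snd.ae huv
  rw [nonlocalEnergy, nonlocalEnergy]
  congr 1
  refine Measure.restrict_congr_set (eventuallyEq_set.2 ?_)
  filter_upwards [h1, h2] with z hz1 hz2
  simp [hz1, hz2]

theorem le_rpow_mul_rpow_neg {x s p e C : ℝ} (hx : 0 ≤ x) (hs : 0 < s) (hp : 0 < p)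
    (h : x ^ p * s ^ e ≤ C) : x ≤ C ^ (1 / p) * s ^ (-(e / p)) := by
  have h0 : 0 ≤ C := le_trans (by positivity) h
  have h1 : x ^ p ≤ C * s ^ (-e) := by
    rw [Real.rpow_neg hs.le, ← div_eq_mul_inv, le_div_iff₀ (by positivity)]
    exact h
  have h2 := Real.rpow_le_rpow (by positivity) h1 (by positivity : 0 ≤ 1 / p)
  rw [← Real.rpow_mul hx, mul_one_div_cancel hp.ne', Real.rpow_one,
    Real.mul_rpow h0 (by positivity), ← Real.rpow_mul hs.le] at h2
  rwa [show -(e / p) = -e * (1 / p) by ring]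

theorem le_toReal_of_mul_ofReal_le {κ Y : ℝ≥0∞} (hκ0 : κ ≠ 0) (hκ : κ ≠ ∞) (hY : Y ≠ ∞) {X : ℝ}
    (h : κ * ENNReal.ofReal X ≤ Y) : X ≤ (Y / κ).toReal := by
  have h1 : ENNReal.ofReal X ≤ Y / κ := by
    rw [ENNReal.le_div_iff_mul_le (Or.inl hκ0) (Or.inl hκ), mul_comm]
    exact h
  exact (ENNReal.ofReal_le_iff_le_toReal (ENNReal.div_ne_top hY hκ0)).1 h1

/-- Profiles of bounded energy drop by at most `C s ^ (-(N - p) / p)` from `s` to `2 s`. -/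
theorem exists_drop_le_of_nonlocalEnergy_le {N : ℕ} {p : ℝ} (hp : 1 < p) (hpN : p < N) (C : ℝ≥0)
    {δ₀ : ℝ} (hδ₀ : 0 ≤ δ₀) :
    ∃ C₁ : ℝ, 0 ≤ C₁ ∧ ∀ (δ : ℝ) (g : ℝ → ℝ), 0 < δ → δ ≤ δ₀ → AntitoneOn g (Set.Ioi 0) →
      nonlocalEnergy p δ (fun x : EuclideanSpace ℝ (Fin N) => g ‖x‖) ≤ C →
      ∀ s, 0 < s → s ≤ 1 → g s ≤ g (2 * s) + C₁ * s ^ (-((N - p) / p)) := by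
  have hN : 0 < Module.finrank ℝ (EuclideanSpace ℝ (Fin N)) := by
    rw [finrank_euclideanSpace_fin]
    exact_mod_cast (by linarith : (0 : ℝ) < N)
  have : Nontrivial (EuclideanSpace ℝ (Fin N)) := Module.nontrivial_of_finrank_pos hN
  set κ := shellConst (volume : Measure (EuclideanSpace ℝ (Fin N))) p with hκ
  set C₀ := (ENNReal.ofReal (2 ^ p) * (3 * (C : ℝ≥0∞)) / κ).toReal with hC₀
  have hC₀0 : 0 ≤ C₀ := ENNReal.toReal_nonneg
  -- The summand `δ₀` covers drops of at most `δ` and the `δ` lost otherwise; it is absorbed because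
  -- $s^{-(N-p)/p}\ge1$ for $s\le1$.
  refine ⟨δ₀ + C₀ ^ (1 / p), by positivity, fun δ g hδ hδδ₀ hg hE s hs hs1 => ?_⟩
  have hs' : 1 ≤ s ^ (-((N - p) / p)) :=
    Real.one_le_rpow_of_pos_of_le_one_of_nonpos hs hs1
      (neg_nonpos.2 (div_nonneg (by linarith) (by linarith)))
  rcases le_or_gt (g s - g (2 * s)) δ with h | h
  · have : 0 ≤ C₀ ^ (1 / p) := by positivity
    nlinarith
  · have h1 := shellConst_mul_le_energy (volume : Measure (EuclideanSpace ℝ (Fin N))) hp hδ hg hs h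
    rw [finrank_euclideanSpace_fin] at h1
    have h2 := le_toReal_of_mul_ofReal_le (shellConst_ne_zero _ p) (shellConst_ne_top _ p)
      (Y := ENNReal.ofReal (2 ^ p) * (3 * (C : ℝ≥0∞)))
      (ENNReal.mul_ne_top ENNReal.ofReal_ne_top
        (ENNReal.mul_ne_top (by norm_num) ENNReal.coe_ne_top))
      (h1.trans (by gcongr; exact hE))
    have h3 := le_rpow_mul_rpow_neg (by linarith) hs (by linarith) h2
    rw [add_mul]
    nlinarith

/-- Growth bound at the origin from a bound on dyadic drops. -/
theorem exists_growth_bound_of_doubling {α C₁ C₂ : ℝ} (hα : 0 < α) (hC₁ : 0 ≤ C₁) (hC₂ : 0 ≤ C₂) :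
    ∃ A : ℝ, ∀ g : ℝ → ℝ, (∀ s, 0 < s → s ≤ 1 → g s ≤ g (2 * s) + C₁ * s ^ (-α)) →
      (∀ s, 1 ≤ s → s ≤ 2 → g s ≤ C₂) → ∀ s, 0 < s → s ≤ 2 → g s ≤ A * s ^ (-α) := by
  have h2 : (2 : ℝ) ^ (-α) < 1 := Real.rpow_lt_one_of_one_lt_of_neg (by norm_num) (by linarith)
  have h2' : (0 : ℝ) < 1 - 2 ^ (-α) := by linarith
  -- The first term handles $[1,2]$; the second gives $A(2s)^{-\alpha}+C_1s^{-\alpha}\le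
  -- As^{-\alpha}$, closing the induction on the number of doublings.
  set A := 2 ^ α * C₂ + C₁ / (1 - 2 ^ (-α)) with hA
  have hA1 : C₂ ≤ A * 2 ^ (-α) := by
    have h3 : (2 : ℝ) ^ α * 2 ^ (-α) = 1 := by
      rw [← Real.rpow_add (by norm_num), add_neg_cancel, Real.rpow_zero]
    have h4 : 0 ≤ C₁ / (1 - 2 ^ (-α)) * 2 ^ (-α) := by positivity
    rw [hA, add_mul, mul_right_comm, h3]
    linarith
  have hA2 : C₁ ≤ A * (1 - 2 ^ (-α)) := by
    rw [hA, add_mul, div_mul_cancel₀ _ h2'.ne']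
    have : 0 ≤ 2 ^ α * C₂ * (1 - 2 ^ (-α)) := by positivity
    linarith
  have hA0 : 0 ≤ A := by positivity
  refine ⟨A, fun g hdrop hbase => ?_⟩
  have hmain : ∀ j : ℕ, ∀ s, 0 < s → s ≤ 2 → 1 ≤ 2 ^ j * s → g s ≤ A * s ^ (-α) := by
    intro j
    have hb : ∀ s, 1 ≤ s → s ≤ 2 → g s ≤ A * s ^ (-α) := fun s hs1 hs2 => by
      refine (hbase s hs1 hs2).trans (hA1.trans ?_)
      gcongr A * ?_
      exact Real.rpow_le_rpow_of_nonpos (by linarith) hs2 (by linarith)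
    induction j with
    | zero =>
      intro s _ hs2 hs1
      exact hb s (by simpa using hs1) hs2
    | succ j ih =>
      intro s hs0 hs2 hs
      rcases le_total 1 s with h | h
      · exact hb s h hs2
      · have h5 := ih (2 * s) (by linarith) (by linarith) (by rw [pow_succ] at hs; linarith)
        rw [Real.mul_rpow (by norm_num) hs0.le] at h5
        have h6 := hdrop s hs0 h
        have h7 : 0 ≤ s ^ (-α) := by positivity
        nlinarith
  intro s hs0 hs2
  obtain ⟨j, hj⟩ := pow_unbounded_of_one_lt (1 / s) (by norm_num : (1 : ℝ) < 2)
  exact hmain j s hs0 hs2 ((div_lt_iff₀ hs0).1 hj).le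

/-! ### Sign, decay at infinity and the majorant -/

section

variable {E : Type*} [NormedAddCommGroup E] [NormedSpace ℝ E]
  [MeasurableSpace E] [BorelSpace E] [FiniteDimensional ℝ E] [Nontrivial E]
  (μ : Measure E) [μ.IsAddHaarMeasure]

/-- A decreasing radial profile in `L^p` is nonnegative. -/
theorem profile_nonneg_of_memLp {p : ℝ} (hp : 0 < p) {g : ℝ → ℝ} (hg : AntitoneOn g (Set.Ioi 0))
    (hgm : MemLp (fun x : E => g ‖x‖) (ENNReal.ofReal p) μ) {t : ℝ} (ht : 0 < t) : 0 ≤ g t := by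
  by_contra! h
  -- Chebyshev: a negative value would persist outside a ball, a set of infinite measure.
  have h1 := mul_meas_ge_le_pow_eLpNorm' μ (ENNReal.ofReal_pos.2 hp).ne' ENNReal.ofReal_ne_top
    hgm.aestronglyMeasurable ‖g t‖ₑ
  have h2 : (Metric.ball (0 : E) t)ᶜ ⊆ {x : E | ‖g t‖ₑ ≤ ‖g ‖x‖‖ₑ} := fun x hx => by
    have hx' : t ≤ ‖x‖ := by simpa using hx
    have h3 := hg (Set.mem_Ioi.2 ht) (Set.mem_Ioi.2 (ht.trans_le hx')) hx'
    rw [Set.mem_ofPred_eq, enorm_le_iff_norm_le, Real.norm_eq_abs, Real.norm_eq_abs,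
      abs_of_neg h, abs_of_neg (h3.trans_lt h)]
    linarith
  have h4 : μ (Metric.ball (0 : E) t)ᶜ = ∞ := by
    rw [measure_compl Metric.isOpen_ball.measurableSet measure_ball_lt_top.ne,
      measure_univ_of_isAddLeftInvariant, ENNReal.top_sub measure_ball_lt_top.ne]
  have h5 : μ {x : E | ‖g t‖ₑ ≤ ‖g ‖x‖‖ₑ} = ∞ := top_le_iff.1 (h4 ▸ measure_mono h2)
  have h6 : ‖g t‖ₑ ^ (ENNReal.ofReal p).toReal ≠ 0 := by
    rw [ENNReal.toReal_ofReal hp.le]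
    exact (ENNReal.rpow_pos (by simpa using h.ne) enorm_ne_top).ne'
  rw [h5, ENNReal.mul_top h6, top_le_iff] at h1
  exact (ENNReal.rpow_ne_top_of_nonneg ENNReal.toReal_nonneg hgm.eLpNorm_lt_top.ne) h1

/-- Decay of decreasing radial profiles that are bounded in `L^p`. -/
theorem exists_decay_bound_of_eLpNorm_le {p : ℝ} (hp : 0 < p) (C : ℝ≥0) :
    ∃ B : ℝ, 0 ≤ B ∧ ∀ g : ℝ → ℝ, AntitoneOn g (Set.Ioi 0) →
      MemLp (fun x : E => g ‖x‖) (ENNReal.ofReal p) μ →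
      eLpNorm (fun x : E => g ‖x‖) (ENNReal.ofReal p) μ ≤ C →
      ∀ t, 0 < t → g t ≤ B * t ^ (-((Module.finrank ℝ E : ℝ) / p)) := by
  have hV0 : μ (Metric.ball 0 1) ≠ 0 := (Metric.measure_ball_pos μ 0 one_pos).ne'
  have hV : μ (Metric.ball 0 1) ≠ ∞ := measure_ball_lt_top.ne
  refine ⟨((C : ℝ≥0∞) ^ p / μ (Metric.ball 0 1)).toReal ^ (1 / p),
    Real.rpow_nonneg ENNReal.toReal_nonneg _, fun g hg hgm hgC t ht => ?_⟩
  have h0 := profile_nonneg_of_memLp μ hp hg hgm ht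
  refine le_rpow_mul_rpow_neg h0 ht hp ?_
  refine le_toReal_of_mul_ofReal_le hV0 hV
    (ENNReal.rpow_ne_top_of_nonneg hp.le ENNReal.coe_ne_top) ?_
  have h1 := mul_meas_ge_le_pow_eLpNorm' μ (ENNReal.ofReal_pos.2 hp).ne' ENNReal.ofReal_ne_top
    hgm.aestronglyMeasurable ‖g t‖ₑ
  -- The origin is removed because `g 0` is unconstrained.
  have h2 : Metric.ball (0 : E) t \ {0} ⊆ {x : E | ‖g t‖ₑ ≤ ‖g ‖x‖‖ₑ} := fun x hx => by
    have hx' : ‖x‖ < t := by simpa using hx.1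
    have hx0 : 0 < ‖x‖ := norm_pos_iff.2 hx.2
    have h3 := hg (Set.mem_Ioi.2 hx0) (Set.mem_Ioi.2 ht) hx'.le
    rw [Set.mem_ofPred_eq, enorm_le_iff_norm_le, Real.norm_eq_abs, Real.norm_eq_abs,
      abs_of_nonneg h0, abs_of_nonneg (h0.trans h3)]
    exact h3
  have h4 : ENNReal.ofReal (t ^ Module.finrank ℝ E) * μ (Metric.ball 0 1) ≤
      μ {x : E | ‖g t‖ₑ ≤ ‖g ‖x‖‖ₑ} := by
    rw [← Measure.addHaar_ball μ 0 ht.le, ← measure_sdiff_null (measure_singleton (0 : E))]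
    exact measure_mono h2
  rw [ENNReal.toReal_ofReal hp.le] at h1
  calc _ = ‖g t‖ₑ ^ p * (ENNReal.ofReal (t ^ Module.finrank ℝ E) * μ (Metric.ball 0 1)) := by
        rw [Real.enorm_eq_ofReal h0, ENNReal.ofReal_rpow_of_nonneg h0 hp.le,
          ENNReal.ofReal_mul (by positivity), Real.rpow_natCast]
        ring
    _ ≤ ‖g t‖ₑ ^ p * μ {x : E | ‖g t‖ₑ ≤ ‖g ‖x‖‖ₑ} := by gcongr
    _ ≤ _ := h1
    _ ≤ _ := by gcongr

/-- The function equal to `A ‖x‖ ^ (-α)` near the origin and to `B ‖x‖ ^ (-β)` at infinity belongs to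
`L^r` for `α r < dim E < β r`. -/
theorem memLp_two_power {r α β : ℝ} (A B : ℝ) (hr : 0 < r) (hα : α * r < Module.finrank ℝ E)
    (hβ : Module.finrank ℝ E < β * r) :
    MemLp (fun x : E => if ‖x‖ ≤ 1 then A * ‖x‖ ^ (-α) else B * ‖x‖ ^ (-β)) (ENNReal.ofReal r) μ := by
  set G : ℝ → ℝ := fun t => if t ≤ 1 then A * t ^ (-α) else B * t ^ (-β) with hG
  have hGm : Measurable G := Measurable.ite measurableSet_Iic
    ((measurable_id.pow_const _).const_mul A) ((measurable_id.pow_const _).const_mul B)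
  have hd : ((Module.finrank ℝ E - 1 : ℕ) : ℝ) = Module.finrank ℝ E - 1 := by
    rw [Nat.cast_sub (Module.finrank_pos : 0 < Module.finrank ℝ E)]
    simp
  have hpow : ∀ (c γ t : ℝ), 0 < t → t ^ (Module.finrank ℝ E - 1) • ‖c * t ^ (-γ)‖ ^ r =
      |c| ^ r * t ^ ((Module.finrank ℝ E : ℝ) - 1 - γ * r) := fun c γ t ht => by
    rw [norm_mul, Real.norm_eq_abs, Real.norm_of_nonneg (by positivity),
      Real.mul_rpow (abs_nonneg c) (by positivity), ← Real.rpow_mul ht.le, smul_eq_mul,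
      ← Real.rpow_natCast, hd, mul_left_comm, ← Real.rpow_add ht]
    ring_nf
  have hint : Integrable (fun x : E => ‖G ‖x‖‖ ^ r) μ := by
    refine (integrable_fun_norm_addHaar μ (f := fun t => ‖G t‖ ^ r)).2 ?_
    rw [← Set.Ioc_union_Ioi_eq_Ioi zero_le_one]
    refine IntegrableOn.union ?_ ?_
    · have h1 : IntegrableOn (fun t : ℝ => |A| ^ r * t ^ ((Module.finrank ℝ E : ℝ) - 1 - α * r))
          (Set.Ioc 0 1) := ((intervalIntegrable_iff_integrableOn_Ioc_of_le zero_le_one).1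
            (intervalIntegral.intervalIntegrable_rpow' (by linarith))).const_mul _
      refine h1.congr_fun (fun t ht => ?_) measurableSet_Ioc
      simp only [hG, if_pos ht.2]
      exact (hpow A α t ht.1).symm
    · have h1 : IntegrableOn (fun t : ℝ => |B| ^ r * t ^ ((Module.finrank ℝ E : ℝ) - 1 - β * r))
          (Set.Ioi 1) := (integrableOn_Ioi_rpow_of_lt (by linarith) one_pos).const_mul _
      refine h1.congr_fun (fun t ht => ?_) measurableSet_Ioi
      simp only [hG, if_neg (not_le.2 (Set.mem_Ioi.1 ht))]
      exact (hpow B β t (one_pos.trans ht)).symm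
  have := (integrable_norm_rpow_iff (μ := μ) (f := fun x : E => G ‖x‖) (p := ENNReal.ofReal r)
    (hGm.comp measurable_norm).aestronglyMeasurable (ENNReal.ofReal_pos.2 hr).ne'
    ENNReal.ofReal_ne_top).1
  rw [ENNReal.toReal_ofReal hr.le] at this
  exact this hint

end

/-! ### Assembly -/

theorem theorem3p4 (N : ℕ) (p : ℝ) (hp : 1 < p) (hpN : p < N)
    (δ : ℕ → ℝ) (hδ_pos : ∀ n, 0 < δ n) (hδ : Tendsto δ atTop (𝓝 0))
    (u : ℕ → EuclideanSpace ℝ (Fin N) → ℝ)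
    (hu : ∀ n, IsRadiallyDecreasing (u n))
    (hu_bdd : IsBoundedInLp volume (ENNReal.ofReal p) u)
    (hI_bdd : ∃ C : ℝ≥0, ∀ n, nonlocalEnergy p (δ n) (u n) ≤ C) :
    ∀ r : ℝ, p < r → r < N * p / (N - p) →
      IsPrecompactInLp volume (ENNReal.ofReal r) u := by
  intro r hpr hrN
  have hdim : Module.finrank ℝ (EuclideanSpace ℝ (Fin N)) = N := finrank_euclideanSpace_fin
  have : Nontrivial (EuclideanSpace ℝ (Fin N)) := Module.nontrivial_of_finrank_pos (R := ℝ) (by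
    rw [hdim]
    exact_mod_cast (by linarith : (0 : ℝ) < N))
  choose f hf huf using hu
  obtain ⟨hmem, C, hC⟩ := hu_bdd
  obtain ⟨C', hC'⟩ := hI_bdd
  -- Convergence of `δ` enters only through a common upper bound.
  obtain ⟨δ₀, hδ₀⟩ := hδ.bddAbove_range
  have hδ₀ : ∀ n, δ n ≤ δ₀ := fun n => hδ₀ ⟨n, rfl⟩
  have hfmem : ∀ n, MemLp (fun x => f n ‖x‖) (ENNReal.ofReal p)
    (volume : Measure (EuclideanSpace ℝ (Fin N))) := fun n => (hmem n).ae_eq (huf n)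
  have hf0 : ∀ n, ∀ t > 0, 0 ≤ f n t := fun n t ht =>
    profile_nonneg_of_memLp volume (by linarith) (hf n) (hfmem n) ht
  obtain ⟨B, hB0, hB⟩ := exists_decay_bound_of_eLpNorm_le
    (volume : Measure (EuclideanSpace ℝ (Fin N))) (by linarith : 0 < p) C
  rw [hdim] at hB
  have hdecay : ∀ n, ∀ t > 0, f n t ≤ B * t ^ (-((N : ℝ) / p)) := fun n t ht =>
    hB _ (hf n) (hfmem n) (by rw [← eLpNorm_congr_ae (huf n)]; exact hC n) t ht
  obtain ⟨C₁, hC₁0, hC₁⟩ := exists_drop_le_of_nonlocalEnergy_le hp hpN C'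
    ((hδ_pos 0).le.trans (hδ₀ 0))
  have hα : 0 < (N - p) / p := div_pos (by linarith) (by linarith)
  obtain ⟨A, hA⟩ := exists_growth_bound_of_doubling hα hC₁0 hB0
  have hgrowth : ∀ n t, 0 < t → t ≤ 2 → f n t ≤ A * t ^ (-((N - p) / p)) := fun n =>
    hA (f n) (hC₁ (δ n) (f n) (hδ_pos n) (hδ₀ n) (hf n)
      (by rw [← nonlocalEnergy_congr_ae (huf n)]; exact hC' n)) fun s hs1 _ => by
        refine (hf n (Set.mem_Ioi.2 one_pos) (Set.mem_Ioi.2 (by linarith)) hs1).trans ?_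
        simpa using hdecay n 1 one_pos
  set G : ℝ → ℝ := fun t => if t ≤ 1 then A * t ^ (-((N - p) / p)) else B * t ^ (-((N : ℝ) / p))
    with hG
  have hfG : ∀ n, ∀ t > 0, |f n t| ≤ G t := fun n t ht => by
    rw [abs_of_nonneg (hf0 n t ht)]
    simp only [hG]
    split_ifs with h
    · exact hgrowth n t ht (by linarith)
    · exact hdecay n t ht
  have hGmem : MemLp (fun x => G ‖x‖) (ENNReal.ofReal r)
      (volume : Measure (EuclideanSpace ℝ (Fin N))) := by
    -- The two conditions are $r<Np/(N-p)$ at the origin and $r>p$ at infinity.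
    refine memLp_two_power volume A B (by linarith) ?_ ?_
    · rw [hdim, div_mul_eq_mul_div, div_lt_iff₀ (by linarith)]
      rw [lt_div_iff₀ (by linarith)] at hrN
      linarith
    · rw [hdim, div_mul_eq_mul_div, lt_div_iff₀ (by linarith)]
      nlinarith
  refine isPrecompactInLp_of_dominated (ENNReal.one_le_ofReal.2 (by linarith))
    ENNReal.ofReal_ne_top (fun n => (hmem n).aestronglyMeasurable) hGmem (fun n => ?_) fun σ => ?_
  · filter_upwards [huf n, ae_norm_notMem_of_countable volume (Set.countable_singleton (0 : ℝ))]
      with x hx hx0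
    rw [hx]
    exact hfG n _ (lt_of_le_of_ne (norm_nonneg x) fun h => hx0 h.symm)
  · obtain ⟨φ, hφ, g, hg⟩ := exists_subseq_ae_tendsto_radial
      (volume : Measure (EuclideanSpace ℝ (Fin N))) (f := fun k => f (σ k)) (fun k => hf _)
      fun k => hfG _
    refine ⟨φ, hφ, g, ?_⟩
    filter_upwards [hg, ae_all_iff.2 huf] with x hx hxu
    simpa [hxu] using hx
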